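/- Let $-\infty\le a<b\le\infty$ and let $\alpha,\beta\colon(a,b)\to\mathbb{R}$ be smooth functions. Let $(K,g_K)$ be a non-empty homogeneous Riemannian manifold, that is, a smooth finite-dimensional Riemannian manifold without boundary whose isometry group acts transitively; for example, $K=\mathbb{S}^2$ with the standard metric $g_{\mathbb{S}^2}$ of the unit sphere in $\mathbb{R}^3$. Let $H=(a,b)\times K$ with the Riemannian metric $$h=\mathrm{e}^{2\alpha(r)}\,\mathrm{d}r^2+\mathrm{e}^{2\beta(r)}\,g_K .$$ Then, for an arbitrary point $p\in(a,b)$, the Riemannian manifold $(H,h)$ is complete (every Cauchy sequence for its Riemannian distance converges) if and only if $$\int_a^p\mathrm{e}^{\alpha(r)}\,\mathrm{d}r=\infty\quad\text{and}\quad\int_p^b\mathrm{e}^{\alpha(r)}\,\mathrm{d}r=\infty .$$ In particular, this equivalence holds for $H=(a,b)\times\mathbb{S}^2$ with $h=\mathrm{e}^{2\alpha(r)}\,\mathrm{d}r^2+\mathrm{e}^{2\beta(r)}\,g_{\mathbb{S}^2}$. -/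

import Mathlib

open scoped Manifold ContDiff Topology ENNReal
open Bundle Filter
namespace WarpedHom

section Pullback
variable {E : Type*} [NormedAddCommGroup E] [NormedSpace ℝ E]
  {H : Type*} [TopologicalSpace H] (I : ModelWithCorners ℝ E H)
  {M : Type*} [TopologicalSpace M] [ChartedSpace H M]
  {E' : Type*} [NormedAddCommGroup E'] [NormedSpace ℝ E']
  {H' : Type*} [TopologicalSpace H'] (I' : ModelWithCorners ℝ E' H')
  {N : Type*} [TopologicalSpace N] [ChartedSpace H' N]

/-- The pullback `(f^* B)_x (v, w) = B_{f x} (df_x v, df_x w)` of a field of bilinear forms. -/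
noncomputable def pullbackForm (f : M → N)
    (B : ∀ y : N, TangentSpace I' y →L[ℝ] TangentSpace I' y →L[ℝ] ℝ) (x : M) :
    TangentSpace I x →L[ℝ] TangentSpace I x →L[ℝ] ℝ :=
  (ContinuousLinearMap.precomp ℝ (mfderiv I I' f x)) ∘L (B (f x)) ∘L (mfderiv I I' f x)

theorem pullbackForm_apply (f : M → N)
    (B : ∀ y : N, TangentSpace I' y →L[ℝ] TangentSpace I' y →L[ℝ] ℝ) (x : M)
    (v w : TangentSpace I x) :
    pullbackForm I I' f B x v w = B (f x) (mfderiv I I' f x v) (mfderiv I I' f x w) := rfl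

variable [IsManifold I ∞ M] [IsManifold I' ∞ N]

theorem contMDiff_pullbackForm {f : M → N} (hf : ContMDiff I I' ∞ f)
    {B : ∀ y : N, TangentSpace I' y →L[ℝ] TangentSpace I' y →L[ℝ] ℝ}
    (hB : ContMDiff I' (I'.prod 𝓘(ℝ, E' →L[ℝ] E' →L[ℝ] ℝ)) ∞
      (fun y : N ↦ TotalSpace.mk' (E' →L[ℝ] E' →L[ℝ] ℝ)
        (E := fun y : N ↦ (TangentSpace I' y →L[ℝ] TangentSpace I' y →L[ℝ] ℝ)) y (B y))) :
    ContMDiff I (I.prod 𝓘(ℝ, E →L[ℝ] E →L[ℝ] ℝ)) ∞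
      (fun x : M ↦ TotalSpace.mk' (E →L[ℝ] E →L[ℝ] ℝ)
        (E := fun x : M ↦ (TangentSpace I x →L[ℝ] TangentSpace I x →L[ℝ] ℝ)) x
        (pullbackForm I I' f B x)) := by
  intro x₀
  rw [contMDiffAt_hom_bundle]
  refine ⟨contMDiffAt_id, ?_⟩
  have h1 := (hB.contMDiffAt (x := f x₀))
  rw [contMDiffAt_hom_bundle] at h1
  have h2 := h1.2.comp x₀ hf.contMDiffAt
  have h3 : ContMDiffAt I 𝓘(ℝ, E →L[ℝ] E') ∞
      (inTangentCoordinates I I' id f (mfderiv I I' f) x₀) x₀ :=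
    hf.contMDiffAt.mfderiv_const (by simp)
  have h4 := (h3.clm_precomp (F₃ := ℝ)).clm_comp (h2.clm_comp h3)
  refine h4.congr_of_eventuallyEq ?_
  have e1 : ∀ᶠ x in 𝓝 x₀, x ∈ (trivializationAt E (TangentSpace I) x₀).baseSet :=
    (trivializationAt E (TangentSpace I) x₀).open_baseSet.mem_nhds
      (FiberBundle.mem_baseSet_trivializationAt' x₀)
  have e2 : ∀ᶠ x in 𝓝 x₀, f x ∈ (trivializationAt E' (TangentSpace I') (f x₀)).baseSet :=
    hf.continuous.continuousAt ((trivializationAt E' (TangentSpace I') (f x₀)).open_baseSet.mem_nhds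
      (FiberBundle.mem_baseSet_trivializationAt' (f x₀)))
  filter_upwards [e1, e2] with x hx hx'
  ext v w
  rw [inCoordinates_apply_eq₂ hx hx (by simp)]
  have key : ∀ u : E, (trivializationAt E' (TangentSpace I') (f x₀)).symm (f x)
      (inTangentCoordinates I I' id f (mfderiv I I' f) x₀ x u)
      = mfderiv I I' f x ((trivializationAt E (TangentSpace I) x₀).symm x u) := by
    intro u
    have h5 : inTangentCoordinates I I' id f (mfderiv I I' f) x₀ x u
        = (trivializationAt E' (TangentSpace I') (f x₀)).continuousLinearEquivAt ℝ (f x) hx'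
          (mfderiv I I' f x (((trivializationAt E (TangentSpace I) x₀).continuousLinearEquivAt
            ℝ x hx).symm u)) :=
      congrArg (fun L : E →L[ℝ] E' ↦ L u)
        (ContinuousLinearMap.inCoordinates_eq (ϕ := mfderiv I I' f x) hx hx')
    rw [h5]
    exact ((trivializationAt E' (TangentSpace I') (f x₀)).continuousLinearEquivAt
      ℝ (f x) hx').symm_apply_apply _
  simp only [ContinuousLinearMap.comp_apply, Function.comp_apply,
    ContinuousLinearMap.precomp_apply]
  rw [inCoordinates_apply_eq₂ hx' hx' (by simp)]
  rw [key, key]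
  rfl

end Pullback

/-- Smooth Riemannian metrics on the manifold `M`. -/
abbrev SmoothMetric {E : Type*} [NormedAddCommGroup E] [NormedSpace ℝ E]
    {H : Type*} [TopologicalSpace H] (I : ModelWithCorners ℝ E H)
    (M : Type*) [TopologicalSpace M] [ChartedSpace H M] [IsManifold I ∞ M] :=
  ContMDiffRiemannianMetric I ∞ E (fun x : M ↦ TangentSpace I x)

theorem isVonNBounded_of_pos {E : Type*} [NormedAddCommGroup E] [NormedSpace ℝ E]
    [FiniteDimensional ℝ E] (B : E →L[ℝ] E →L[ℝ] ℝ) (hB : ∀ v, v ≠ 0 → 0 < B v v) :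
    Bornology.IsVonNBounded ℝ {v : E | B v v < 1} := by
  rw [NormedSpace.isVonNBounded_iff]
  have hc : Continuous fun v : E ↦ B v v := by fun_prop
  rcases (Metric.sphere (0 : E) 1).eq_empty_or_nonempty with h | h
  · have : Subsingleton E := by
      refine ⟨fun x y ↦ ?_⟩
      by_contra hxy
      have hn : ‖x - y‖ ≠ 0 := norm_ne_zero_iff.2 (sub_ne_zero.2 hxy)
      have : ‖x - y‖⁻¹ • (x - y) ∈ Metric.sphere (0 : E) 1 := by
        simp [norm_smul, hn]
      simp [h] at this
    exact (Set.toFinite _).isBounded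
  · obtain ⟨m, hm, hmin⟩ := (isCompact_sphere (0 : E) 1).exists_isMinOn h hc.continuousOn
    have hm0 : m ≠ 0 := by
      rintro rfl
      simp at hm
    have hpos := hB m hm0
    refine (Metric.isBounded_iff_subset_closedBall 0).2 ⟨1 + (B m m)⁻¹, fun v hv ↦ ?_⟩
    simp only [Set.mem_ofPred_eq] at hv
    rcases eq_or_ne v 0 with rfl | hv0
    · simp; positivity
    have hn : 0 < ‖v‖ := norm_pos_iff.2 hv0
    have h1 : ‖v‖⁻¹ • v ∈ Metric.sphere (0 : E) 1 := by simp [norm_smul, hn.ne']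
    have h2 : B m m ≤ ‖v‖⁻¹ * (‖v‖⁻¹ * B v v) := by
      simpa using hmin h1
    have h3 : B m m * ‖v‖ ^ 2 ≤ B v v := by
      have := mul_le_mul_of_nonneg_right h2 (sq_nonneg ‖v‖)
      field_simp at this
      linarith
    have h4 : ‖v‖ ^ 2 ≤ (B m m)⁻¹ := by
      rw [← one_div, le_div_iff₀ hpos]
      linarith
    simp only [mem_closedBall_zero_iff]
    nlinarith [sq_nonneg (‖v‖ - 1), inv_pos.2 hpos]

/-- The interval `(a, b)` of the real line, with possibly infinite end points, as an open
submanifold of `ℝ`. -/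
def openInterval (a b : EReal) : TopologicalSpace.Opens ℝ :=
  ⟨{r : ℝ | a < r ∧ (r : EReal) < b},
    (isOpen_Ioo (a := a) (b := b)).preimage continuous_coe_real_ereal⟩


theorem hasMFDerivAt_val (a b : EReal) (r : openInterval a b) :
    HasMFDerivAt 𝓘(ℝ, ℝ) 𝓘(ℝ, ℝ) (fun r : openInterval a b ↦ (r : ℝ)) r
      (ContinuousLinearMap.id ℝ ℝ) := by
  refine ⟨continuous_subtype_val.continuousAt, ?_⟩
  have hr : r.1 ∈ (openInterval a b : Set ℝ) := r.2
  have key : ∀ x ∈ (openInterval a b : Set ℝ),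
      writtenInExtChartAt 𝓘(ℝ, ℝ) 𝓘(ℝ, ℝ) r (fun r : openInterval a b ↦ (r : ℝ)) x = x := by
    intro x hx
    have hs : (⟨x, hx⟩ : openInterval a b) ∈ (chartAt ℝ r).source := by
      simp [TopologicalSpace.Opens.chartAt_eq, chartAt_self_eq]
    exact congrArg Subtype.val ((chartAt ℝ r).left_inv hs)
  refine ((hasFDerivAt_id _).hasFDerivWithinAt).congr_of_eventuallyEq ?_ (key _ hr)
  filter_upwards [mem_nhdsWithin_of_mem_nhds ((openInterval a b).isOpen.mem_nhds hr)] with x hx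
  exact key x hx

section Warped
variable {E : Type*} [NormedAddCommGroup E] [NormedSpace ℝ E]
  {H : Type*} [TopologicalSpace H] {I : ModelWithCorners ℝ E H}
  {K : Type*} [TopologicalSpace K] [ChartedSpace H K] [IsManifold I ∞ K]

/-- The field of bilinear forms `e^{2α(r)} dr² + e^{2β(r)} g` on `(a,b) × K`. -/
noncomputable def warpedForm (a b : EReal) (α β : ℝ → ℝ) (g : SmoothMetric I K) (p : openInterval a b × K) :
    TangentSpace (𝓘(ℝ, ℝ).prod I) p →L[ℝ] TangentSpace (𝓘(ℝ, ℝ).prod I) p →L[ℝ] ℝ :=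
  Real.exp (2 * α p.1) • pullbackForm (𝓘(ℝ, ℝ).prod I) 𝓘(ℝ, ℝ)
      (fun q : openInterval a b × K ↦ (q.1 : ℝ)) (riemannianMetricVectorSpace ℝ).inner p
  + Real.exp (2 * β p.1) • pullbackForm (𝓘(ℝ, ℝ).prod I) I
      (fun q : openInterval a b × K ↦ q.2) g.inner p

theorem warpedForm_apply (a b : EReal) (α β : ℝ → ℝ) (g : SmoothMetric I K)
    (p : openInterval a b × K) (v w : ℝ × E) :
    warpedForm a b α β g p v w = Real.exp (2 * α p.1) * (v.1 * w.1)
      + Real.exp (2 * β p.1) * g.inner p.2 v.2 w.2 := by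
  have h1 : mfderiv (𝓘(ℝ, ℝ).prod I) 𝓘(ℝ, ℝ) (fun q : openInterval a b × K ↦ (q.1 : ℝ)) p
      = ContinuousLinearMap.fst ℝ ℝ E :=
    ((hasMFDerivAt_val a b p.1).comp p (hasMFDerivAt_fst p)).mfderiv
  have h2 : mfderiv (𝓘(ℝ, ℝ).prod I) I (fun q : openInterval a b × K ↦ q.2) p
      = ContinuousLinearMap.snd ℝ ℝ E := mfderiv_snd
  have h3 : ∀ (r : ℝ) (s t : ℝ), (riemannianMetricVectorSpace ℝ).inner r s t = s * t :=
    fun r s t ↦ mul_comm t s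
  have h4 : pullbackForm (𝓘(ℝ, ℝ).prod I) 𝓘(ℝ, ℝ) (fun q : openInterval a b × K ↦ (q.1 : ℝ))
      (riemannianMetricVectorSpace ℝ).inner p v w = v.1 * w.1 := by
    exact (congrArg (fun L : ℝ × E →L[ℝ] ℝ ↦
      (riemannianMetricVectorSpace ℝ).inner (p.1 : ℝ) (L v) (L w)) h1).trans (h3 _ _ _)
  have h5 : pullbackForm (𝓘(ℝ, ℝ).prod I) I (fun q : openInterval a b × K ↦ q.2)
      g.inner p v w = g.inner p.2 v.2 w.2 := by
    exact congrArg (fun L : ℝ × E →L[ℝ] E ↦ g.inner p.2 (L v) (L w)) h2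
  rw [← h4, ← h5]
  rfl

theorem contMDiff_warpedForm {a b : EReal} {α β : ℝ → ℝ}
    (hα : ContDiffOn ℝ ∞ α (openInterval a b)) (hβ : ContDiffOn ℝ ∞ β (openInterval a b))
    (g : SmoothMetric I K) :
    ContMDiff (𝓘(ℝ, ℝ).prod I)
      ((𝓘(ℝ, ℝ).prod I).prod 𝓘(ℝ, (ℝ × E) →L[ℝ] (ℝ × E) →L[ℝ] ℝ)) ∞
      (fun p : openInterval a b × K ↦ TotalSpace.mk' ((ℝ × E) →L[ℝ] (ℝ × E) →L[ℝ] ℝ)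
        (E := fun p : openInterval a b × K ↦ (TangentSpace (𝓘(ℝ, ℝ).prod I) p →L[ℝ]
          TangentSpace (𝓘(ℝ, ℝ).prod I) p →L[ℝ] ℝ)) p (warpedForm a b α β g p)) := by
  have hval : ContMDiff (𝓘(ℝ, ℝ).prod I) 𝓘(ℝ, ℝ) ∞
      (fun q : openInterval a b × K ↦ (q.1 : ℝ)) := contMDiff_subtype_val.comp contMDiff_fst
  have hc : ∀ {φ : ℝ → ℝ}, ContDiffOn ℝ ∞ φ (openInterval a b) →
      ContMDiff (𝓘(ℝ, ℝ).prod I) 𝓘(ℝ, ℝ) ∞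
      (fun q : openInterval a b × K ↦ Real.exp (2 * φ q.1)) := by
    intro φ hφ
    have := hφ.contMDiffOn.comp_contMDiff hval (fun q ↦ q.1.2)
    have h2 : ContDiff ℝ ∞ (fun x : ℝ ↦ Real.exp (2 * x)) := by fun_prop
    exact h2.contMDiff.comp this
  have hstd := (riemannianMetricVectorSpace ℝ).contMDiff.of_le (m := ∞) le_top
  exact ((hc hα).smul_section (contMDiff_pullbackForm _ _ hval hstd)).add_section
    ((hc hβ).smul_section (contMDiff_pullbackForm _ _ contMDiff_snd g.contMDiff))

/-- The Riemannian metric `e^{2α(r)} dr² + e^{2β(r)} g` on `(a,b) × K`. -/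
noncomputable def warpedMetric [FiniteDimensional ℝ E] (a b : EReal) (α β : ℝ → ℝ)
    (hα : ContDiffOn ℝ ∞ α (openInterval a b)) (hβ : ContDiffOn ℝ ∞ β (openInterval a b))
    (g : SmoothMetric I K) : SmoothMetric (𝓘(ℝ, ℝ).prod I) (openInterval a b × K) :=
  have hpos : ∀ (p : openInterval a b × K) (v : ℝ × E), v ≠ 0 →
      0 < warpedForm a b α β g p v v := by
    intro p v hv
    rw [warpedForm_apply]
    have h1 := Real.exp_pos (2 * α p.1)
    have h2 := Real.exp_pos (2 * β p.1)
    by_cases h : v.2 = 0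
    · have h3 : v.1 ≠ 0 := fun h' ↦ hv (Prod.ext h' h)
      have h4 : 0 < v.1 * v.1 := mul_self_pos.2 h3
      have h5 : g.inner p.2 v.2 v.2 = 0 := by rw [h]; exact map_zero _
      rw [h5]
      positivity
    · have := g.pos p.2 v.2 h
      have := mul_self_nonneg v.1
      positivity
  have hsymm : ∀ (p : openInterval a b × K) (v w : ℝ × E),
      warpedForm a b α β g p v w = warpedForm a b α β g p w v := by
    intro p v w
    rw [warpedForm_apply, warpedForm_apply, mul_comm v.1]
    exact congrArg (fun t ↦ _ + _ * t) (g.symm p.2 v.2 w.2)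
  { inner := warpedForm a b α β g
    symm := hsymm
    pos := hpos
    isVonNBounded := fun p ↦ isVonNBounded_of_pos (E := ℝ × E) (warpedForm a b α β g p) (hpos p)
    contMDiff := contMDiff_warpedForm hα hβ g }

end Warped

/-- The standard metric on the unit sphere `S²`, induced by the Euclidean metric of `ℝ³`. -/
noncomputable def sphereMetric : SmoothMetric (𝓡 2) (Metric.sphere (0 : EuclideanSpace ℝ (Fin 3)) 1) :=
  haveI : Fact (Module.finrank ℝ (EuclideanSpace ℝ (Fin 3)) = 2 + 1) :=
    ⟨by simp⟩
  have hpos : ∀ (x : Metric.sphere (0 : EuclideanSpace ℝ (Fin 3)) 1) (v : TangentSpace (𝓡 2) x),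
      v ≠ 0 → 0 < pullbackForm (𝓡 2) 𝓘(ℝ, EuclideanSpace ℝ (Fin 3))
        (fun x : Metric.sphere (0 : EuclideanSpace ℝ (Fin 3)) 1 ↦ (x : EuclideanSpace ℝ (Fin 3)))
        (riemannianMetricVectorSpace (EuclideanSpace ℝ (Fin 3))).inner x v v := by
    intro x v hv
    refine (riemannianMetricVectorSpace (EuclideanSpace ℝ (Fin 3))).pos _ _ fun h ↦ hv ?_
    exact injective_mvfderiv_subtypeVal_sphere x (h.trans (map_zero _).symm)
  { inner := pullbackForm (𝓡 2) 𝓘(ℝ, EuclideanSpace ℝ (Fin 3))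
      (fun x : Metric.sphere (0 : EuclideanSpace ℝ (Fin 3)) 1 ↦ (x : EuclideanSpace ℝ (Fin 3)))
      (riemannianMetricVectorSpace (EuclideanSpace ℝ (Fin 3))).inner
    symm := fun x v w ↦ (riemannianMetricVectorSpace (EuclideanSpace ℝ (Fin 3))).symm _ _ _
    pos := hpos
    isVonNBounded := fun x ↦ isVonNBounded_of_pos (E := EuclideanSpace ℝ (Fin 2))
      (pullbackForm (𝓡 2) 𝓘(ℝ, EuclideanSpace ℝ (Fin 3))
        (fun x : Metric.sphere (0 : EuclideanSpace ℝ (Fin 3)) 1 ↦ (x : EuclideanSpace ℝ (Fin 3)))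
        (riemannianMetricVectorSpace (EuclideanSpace ℝ (Fin 3))).inner x) (hpos x)
    contMDiff := contMDiff_pullbackForm _ _ contMDiff_coe_sphere
      ((riemannianMetricVectorSpace (EuclideanSpace ℝ (Fin 3))).contMDiff.of_le le_top) }

section Complete
variable {E : Type*} [NormedAddCommGroup E] [NormedSpace ℝ E]
  {H : Type*} [TopologicalSpace H] {I : ModelWithCorners ℝ E H}
  {M : Type*} [TopologicalSpace M] [ChartedSpace H M] [IsManifold I ∞ M]

/-- The Riemannian distance of `g`: the infimum of the lengths of the `C¹` paths from `x` to `y`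
(infinite for points in different components). -/
noncomputable def riemDist (g : SmoothMetric I M) (x y : M) : ℝ≥0∞ :=
  letI : RiemannianBundle (fun x : M ↦ TangentSpace I x) := ⟨g.toRiemannianMetric⟩
  Manifold.riemannianEDist I x y

/-- Completeness of the Riemannian manifold `(M, g)`: every sequence that is Cauchy for the
Riemannian distance converges. -/
def IsCompleteRiemannian (g : SmoothMetric I M) : Prop :=
  ∀ u : ℕ → M,
    (∀ ε : ℝ≥0∞, 0 < ε → ∃ n₀ : ℕ, ∀ m ≥ n₀, ∀ n ≥ n₀, riemDist g (u m) (u n) < ε) →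
    ∃ x : M, Tendsto (fun n ↦ riemDist g (u n) x) atTop (𝓝 0)

/-- `φ` preserves the metric `g`. -/
def IsIsometry (g : SmoothMetric I M) (φ : M ≃ₘ^∞⟮I, I⟯ M) : Prop :=
  ∀ (x : M) (v w : TangentSpace I x),
    g.inner (φ x) (mfderiv I I φ x v) (mfderiv I I φ x w) = g.inner x v w

/-- `(M, g)` is homogeneous: its isometry group acts transitively. -/
def IsHomogeneous (g : SmoothMetric I M) : Prop :=
  ∀ x y : M, ∃ φ : M ≃ₘ^∞⟮I, I⟯ M, IsIsometry g φ ∧ φ x = y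

end Complete
end WarpedHom

namespace WarpedHom
open MeasureTheory Set

section Length
variable {E : Type*} [NormedAddCommGroup E] [NormedSpace ℝ E]
  {H : Type*} [TopologicalSpace H] {I : ModelWithCorners ℝ E H}
  {M : Type*} [TopologicalSpace M] [ChartedSpace H M] [IsManifold I ∞ M]
  {E' : Type*} [NormedAddCommGroup E'] [NormedSpace ℝ E']
  {H' : Type*} [TopologicalSpace H'] {I' : ModelWithCorners ℝ E' H'}
  {N : Type*} [TopologicalSpace N] [ChartedSpace H' N] [IsManifold I' ∞ N]

theorem SmoothMetric.inner_self_nonneg (g : SmoothMetric I M) (x : M)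
    (v : TangentSpace I x) : 0 ≤ g.inner x v v := by
  rcases eq_or_ne v 0 with rfl | hv
  · simp
  · exact (g.pos x v hv).le

/-- The velocity of a curve. -/
noncomputable def velocity (I : ModelWithCorners ℝ E H) (γ : ℝ → M) (u : ℝ) :
    TangentSpace I (γ u) :=
  mfderiv 𝓘(ℝ, ℝ) I γ u (1 : ℝ)

/-- The length of the curve `γ` on `[s, t]` for the metric `g`. -/
noncomputable def curveLength (g : SmoothMetric I M) (γ : ℝ → M) (s t : ℝ) : ℝ≥0∞ :=
  ∫⁻ u in Icc s t, ENNReal.ofReal √(g.inner (γ u) (velocity I γ u) (velocity I γ u))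

theorem curveLength_eq_pathELength (g : SmoothMetric I M) (γ : ℝ → M) (s t : ℝ) :
    letI : RiemannianBundle (fun x : M ↦ TangentSpace I x) := ⟨g.toRiemannianMetric⟩
    Manifold.pathELength I γ s t = curveLength g γ s t := by
  let _ : RiemannianBundle (fun x : M ↦ TangentSpace I x) := ⟨g.toRiemannianMetric⟩
  rw [Manifold.pathELength_eq_lintegral_mfderiv_Icc]
  refine lintegral_congr fun u ↦ ?_
  rw [← ofReal_norm, norm_eq_sqrt_real_inner]
  rfl

theorem curveLength_mono (g : SmoothMetric I M) (γ : ℝ → M) {s t s' t' : ℝ} (h : s' ≤ s)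
    (h' : t ≤ t') : curveLength g γ s t ≤ curveLength g γ s' t' :=
  lintegral_mono_set (Icc_subset_Icc h h')

theorem riemDist_le_curveLength (g : SmoothMetric I M) {γ : ℝ → M} {s t : ℝ}
    (hγ : ContMDiffOn 𝓘(ℝ, ℝ) I 1 γ (Icc s t)) (hst : s ≤ t) :
    riemDist g (γ s) (γ t) ≤ curveLength g γ s t := by
  let _ : RiemannianBundle (fun x : M ↦ TangentSpace I x) := ⟨g.toRiemannianMetric⟩
  rw [← curveLength_eq_pathELength]
  exact Manifold.riemannianEDist_le_pathELength hγ rfl rfl hst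

theorem exists_curveLength_lt (g : SmoothMetric I M) {x y : M} {r : ℝ≥0∞}
    (h : riemDist g x y < r) :
    ∃ γ : ℝ → M, γ 0 = x ∧ γ 1 = y ∧ ContMDiff 𝓘(ℝ, ℝ) I 1 γ ∧ curveLength g γ 0 1 < r := by
  let _ : RiemannianBundle (fun x : M ↦ TangentSpace I x) := ⟨g.toRiemannianMetric⟩
  obtain ⟨γ, h0, h1, hγ, hl, -⟩ :=
    Manifold.exists_lt_locally_constant_of_riemannianEDist_lt h zero_lt_one
  rw [curveLength_eq_pathELength] at hl
  exact ⟨γ, h0, h1, hγ, hl⟩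

theorem riemDist_comm (g : SmoothMetric I M) (x y : M) : riemDist g x y = riemDist g y x := by
  let _ : RiemannianBundle (fun x : M ↦ TangentSpace I x) := ⟨g.toRiemannianMetric⟩
  exact Manifold.riemannianEDist_comm

theorem riemDist_triangle (g : SmoothMetric I M) (x y z : M) :
    riemDist g x z ≤ riemDist g x y + riemDist g y z := by
  let _ : RiemannianBundle (fun x : M ↦ TangentSpace I x) := ⟨g.toRiemannianMetric⟩
  exact Manifold.riemannianEDist_triangle

omit [IsManifold I ∞ M] [IsManifold I' ∞ N] in
theorem velocity_comp {f : M → N} {γ : ℝ → M} {u : ℝ}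
    (hf : MDifferentiableAt I I' f (γ u)) (hγ : MDifferentiableAt 𝓘(ℝ, ℝ) I γ u) :
    velocity I' (f ∘ γ) u = mfderiv I I' f (γ u) (velocity I γ u) :=
  congrArg (fun L : ℝ →L[ℝ] E' ↦ L 1) (mfderiv_comp u hf hγ)

/-- A map expanding the metric by at most `C ^ 2` along a curve expands its length by at
most `C`. -/
theorem curveLength_comp_le (g : SmoothMetric I M) (g' : SmoothMetric I' N) {f : M → N}
    (hf : ContMDiff I I' 1 f) {γ : ℝ → M} (hγ : ContMDiff 𝓘(ℝ, ℝ) I 1 γ) {C s t : ℝ} (hC : 0 ≤ C)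
    (h : ∀ u ∈ Icc s t, ∀ v : TangentSpace I (γ u),
      g'.inner (f (γ u)) (mfderiv I I' f (γ u) v) (mfderiv I I' f (γ u) v)
        ≤ C ^ 2 * g.inner (γ u) v v) :
    curveLength g' (f ∘ γ) s t ≤ ENNReal.ofReal C * curveLength g γ s t := by
  rw [curveLength, curveLength, ← lintegral_const_mul' _ _ ENNReal.ofReal_ne_top]
  refine setLIntegral_mono' measurableSet_Icc fun u hu ↦ ?_
  rw [velocity_comp (hf.mdifferentiable one_ne_zero _) (hγ.mdifferentiable one_ne_zero _),
    ← ENNReal.ofReal_mul hC]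
  refine ENNReal.ofReal_le_ofReal ?_
  refine (Real.sqrt_le_sqrt (h u hu _)).trans_eq ?_
  rw [Real.sqrt_mul (sq_nonneg C), Real.sqrt_sq hC]

theorem riemDist_map_le (g : SmoothMetric I M) (g' : SmoothMetric I' N) {f : M → N}
    (hf : ContMDiff I I' 1 f) {C : ℝ} (hC : 0 < C)
    (h : ∀ (x : M) (v : TangentSpace I x),
      g'.inner (f x) (mfderiv I I' f x v) (mfderiv I I' f x v) ≤ C ^ 2 * g.inner x v v)
    (x y : M) : riemDist g' (f x) (f y) ≤ ENNReal.ofReal C * riemDist g x y := by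
  have key : ∀ r, riemDist g x y < r → riemDist g' (f x) (f y) ≤ ENNReal.ofReal C * r := by
    intro r hr
    obtain ⟨γ, rfl, rfl, hγ, hl⟩ := exists_curveLength_lt g hr
    exact (riemDist_le_curveLength g' (hf.comp hγ).contMDiffOn zero_le_one).trans
      ((curveLength_comp_le g g' hf hγ hC.le fun u _ v ↦ h _ v).trans (by gcongr))
  rcases eq_or_ne (riemDist g x y) ⊤ with htop | htop
  · rw [htop, ENNReal.mul_top (by simpa using hC)]
    exact le_top
  · have hlim : Tendsto (fun r ↦ ENNReal.ofReal C * r) (𝓝[>] (riemDist g x y))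
        (𝓝 (ENNReal.ofReal C * riemDist g x y)) :=
      (ENNReal.Tendsto.const_mul tendsto_id (Or.inr ENNReal.ofReal_ne_top)).mono_left
        nhdsWithin_le_nhds
    have := nhdsGT_neBot_of_exists_gt ⟨⊤, htop.lt_top⟩
    exact ge_of_tendsto hlim (eventually_mem_nhdsWithin.mono key)

theorem edist_le_curveLength (g : SmoothMetric I M) {f : M → ℝ}
    (hf : ContMDiff I 𝓘(ℝ, ℝ) 1 f) {γ : ℝ → M} (hγ : ContMDiff 𝓘(ℝ, ℝ) I 1 γ) {s t : ℝ}
    (hst : s ≤ t)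
    (h : ∀ (x : M) (v : TangentSpace I x), ∀ c : ℝ, c = mfderiv I 𝓘(ℝ, ℝ) f x v →
      c ^ 2 ≤ g.inner x v v) :
    edist (f (γ s)) (f (γ t)) ≤ curveLength g γ s t := by
  have hfγ : ContDiff ℝ 1 (f ∘ γ) := (hf.comp hγ).contDiff
  rw [edist_comm, edist_eq_enorm_sub]
  refine (enorm_sub_le_lintegral_derivWithin_Icc_of_contDiffOn_Icc
    (f := f ∘ γ) hfγ.contDiffOn hst).trans ?_
  rw [curveLength, ← restrict_Ioo_eq_restrict_Icc]
  refine setLIntegral_mono' measurableSet_Ioo fun u hu ↦ ?_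
  rw [derivWithin_of_mem_nhds (Icc_mem_nhds hu.1 hu.2), ← ofReal_norm, Real.norm_eq_abs]
  refine ENNReal.ofReal_le_ofReal (Real.abs_le_sqrt (h _ _ _ ?_))
  rw [← velocity_comp (hf.mdifferentiable one_ne_zero _) (hγ.mdifferentiable one_ne_zero _)]
  simp only [velocity, mfderiv_eq_fderiv]
  exact fderiv_apply_one_eq_deriv.symm

theorem edist_le_riemDist (g : SmoothMetric I M) {f : M → ℝ}
    (hf : ContMDiff I 𝓘(ℝ, ℝ) 1 f)
    (h : ∀ (x : M) (v : TangentSpace I x), ∀ c : ℝ, c = mfderiv I 𝓘(ℝ, ℝ) f x v →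
      c ^ 2 ≤ g.inner x v v) (x y : M) :
    edist (f x) (f y) ≤ riemDist g x y := by
  refine le_of_forall_gt fun r hr ↦ ?_
  obtain ⟨γ, rfl, rfl, hγ, hl⟩ := exists_curveLength_lt g hr
  exact (edist_le_curveLength g hf hγ zero_le_one h).trans_lt hl

end Length

section CompleteFibre
variable {E : Type*} [NormedAddCommGroup E] [NormedSpace ℝ E]
  {H : Type*} [TopologicalSpace H] {I : ModelWithCorners ℝ E H}
  {M : Type*} [TopologicalSpace M] [ChartedSpace H M] [IsManifold I ∞ M]

theorem exists_riemDist_ball_subset [RegularSpace M] (g : SmoothMetric I M) {x : M} {s : Set M}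
    (hs : s ∈ 𝓝 x) : ∃ ε > 0, {y | riemDist g x y < ε} ⊆ s := by
  let _ : RiemannianBundle (fun x : M ↦ TangentSpace I x) := ⟨g.toRiemannianMetric⟩
  have : IsManifold I 1 M := .of_le (n := ∞) (by simp)
  have : IsContinuousRiemannianBundle E (fun x : M ↦ TangentSpace I x) :=
    ⟨g.inner, g.contMDiff.continuous, fun _ _ _ ↦ rfl⟩
  exact setOfPred_riemannianEDist_lt_subset_nhds' I hs

/-- A Riemannian manifold in which all balls of some fixed radius are relatively compact is
complete. -/
theorem isCompleteRiemannian_of_uniformly_compact [RegularSpace M] (g : SmoothMetric I M)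
    {ε : ℝ≥0∞} (hε : 0 < ε)
    (h : ∀ x : M, ∃ S : Set M, IsCompact S ∧ {y | riemDist g x y < ε} ⊆ S) :
    IsCompleteRiemannian g := by
  let _ : RiemannianBundle (fun x : M ↦ TangentSpace I x) := ⟨g.toRiemannianMetric⟩
  have : IsManifold I 1 M := .of_le (n := ∞) (by simp)
  have : IsContinuousRiemannianBundle E (fun x : M ↦ TangentSpace I x) :=
    ⟨g.inner, g.contMDiff.continuous, fun _ _ _ ↦ rfl⟩
  let _ : PseudoEMetricSpace M := PseudoEMetricSpace.ofRiemannianMetric I M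
  intro u hu
  have hc : CauchySeq u := EMetric.cauchySeq_iff.2 hu
  obtain ⟨n₀, hn₀⟩ := hu ε hε
  obtain ⟨S, hS, hS'⟩ := h (u n₀)
  have hm : ∀ᶠ n in atTop, u n ∈ S :=
    eventually_atTop.2 ⟨n₀, fun n hn ↦ hS' (hn₀ n₀ le_rfl n hn)⟩
  obtain ⟨x, -, hx⟩ := hS.isComplete (map u atTop) hc (tendsto_principal.2 hm)
  exact ⟨x, tendsto_iff_edist_tendsto_0.1 hx⟩

theorem isCompleteRiemannian_of_compactSpace [RegularSpace M] [CompactSpace M]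
    (g : SmoothMetric I M) : IsCompleteRiemannian g :=
  isCompleteRiemannian_of_uniformly_compact g zero_lt_one
    fun _ ↦ ⟨univ, isCompact_univ, subset_univ _⟩

theorem IsIsometry.riemDist_le {g : SmoothMetric I M} {φ : M ≃ₘ^∞⟮I, I⟯ M}
    (hφ : IsIsometry g φ) (x y : M) : riemDist g (φ x) (φ y) ≤ riemDist g x y := by
  have := riemDist_map_le g g (φ.contMDiff.of_le (m := 1) (by simp)) zero_lt_one
    (fun x v ↦ by rw [one_pow, one_mul]; exact (hφ x v v).le) x y
  simpa using this

theorem IsHomogeneous.isCompleteRiemannian [FiniteDimensional ℝ E] [T2Space M]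
    {g : SmoothMetric I M} (hg : IsHomogeneous g) : IsCompleteRiemannian g := by
  have : LocallyCompactSpace M := Manifold.locallyCompact_of_finiteDimensional I
  intro u
  obtain ⟨S, hS, hSu⟩ := exists_compact_mem_nhds (u 0)
  obtain ⟨ε, hε, hεS⟩ := exists_riemDist_ball_subset g hSu
  refine isCompleteRiemannian_of_uniformly_compact g hε (fun x ↦ ?_) u
  obtain ⟨φ, hφ, hx⟩ := hg x (u 0)
  refine ⟨φ ⁻¹' S, φ.toHomeomorph.isCompact_preimage.2 hS, fun y hy ↦ hεS ?_⟩
  rw [← hx]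
  exact (hφ.riemDist_le x y).trans_lt hy

end CompleteFibre

section ArcLength
variable {a b : EReal} {α : ℝ → ℝ} {p : ℝ}

instance ordConnected_openInterval (a b : EReal) : (openInterval a b : Set ℝ).OrdConnected :=
  ⟨fun _ hx _ hy _ hz ↦ ⟨hx.1.trans_le (EReal.coe_le_coe_iff.2 hz.1),
    (EReal.coe_le_coe_iff.2 hz.2).trans_lt hy.2⟩⟩

theorem exists_openInterval_lt {r : ℝ} (hr : r ∈ openInterval a b) :
    ∃ q : ℚ, (q : ℝ) ∈ openInterval a b ∧ (q : ℝ) < r := by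
  obtain ⟨q, hq, hqr⟩ := EReal.lt_iff_exists_rat_btwn.1 hr.1
  exact ⟨q, ⟨hq, hqr.trans hr.2⟩, EReal.coe_lt_coe_iff.1 hqr⟩

theorem exists_openInterval_gt {r : ℝ} (hr : r ∈ openInterval a b) :
    ∃ q : ℚ, (q : ℝ) ∈ openInterval a b ∧ r < (q : ℝ) := by
  obtain ⟨q, hrq, hq⟩ := EReal.lt_iff_exists_rat_btwn.1 hr.2
  exact ⟨q, ⟨hr.1.trans hrq, hq⟩, EReal.coe_lt_coe_iff.1 hrq⟩

/-- The signed arc length from `p` to `r` of the line element `e^α dr`. -/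
noncomputable def arcLength (α : ℝ → ℝ) (p r : ℝ) : ℝ := ∫ x in p..r, Real.exp (α x)

theorem arcLength_self (α : ℝ → ℝ) (p : ℝ) : arcLength α p p = 0 :=
  intervalIntegral.integral_same

variable (hα : ContinuousOn α (openInterval a b)) (hp : p ∈ openInterval a b)
include hα

theorem intervalIntegrable_exp {r s : ℝ} (hr : r ∈ openInterval a b)
    (hs : s ∈ openInterval a b) : IntervalIntegrable (fun x ↦ Real.exp (α x)) volume r s :=
  ((Real.continuous_exp.comp_continuousOn hα).mono
    ((ordConnected_openInterval a b).uIcc_subset hr hs)).intervalIntegrable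

include hp

theorem hasDerivAt_arcLength {r : ℝ} (hr : r ∈ openInterval a b) :
    HasDerivAt (arcLength α p) (Real.exp (α r)) r := by
  have hc : ContinuousOn (fun x ↦ Real.exp (α x)) (openInterval a b) :=
    Real.continuous_exp.comp_continuousOn hα
  exact intervalIntegral.integral_hasDerivAt_right (intervalIntegrable_exp hα hp hr)
    (hc.stronglyMeasurableAtFilter (openInterval a b).isOpen r hr)
    (hc.continuousAt ((openInterval a b).isOpen.mem_nhds hr))

theorem continuousOn_arcLength : ContinuousOn (arcLength α p) (openInterval a b) :=
  fun _ hr ↦ (hasDerivAt_arcLength hα hp hr).continuousAt.continuousWithinAt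

theorem contDiffOn_arcLength : ContDiffOn ℝ 1 (arcLength α p) (openInterval a b) := by
  rw [show (1 : ℕ∞ω) = 0 + 1 by simp,
    contDiffOn_succ_iff_deriv_of_isOpen (openInterval a b).isOpen]
  refine ⟨fun r hr ↦ (hasDerivAt_arcLength hα hp hr).differentiableAt.differentiableWithinAt,
    by simp, contDiffOn_zero.2 ?_⟩
  exact (Real.continuous_exp.comp_continuousOn hα).congr
    fun r hr ↦ (hasDerivAt_arcLength hα hp hr).deriv

theorem strictMonoOn_arcLength : StrictMonoOn (arcLength α p) (openInterval a b) := by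
  refine strictMonoOn_of_deriv_pos (ordConnected_openInterval a b).convex
    (continuousOn_arcLength hα hp) fun r hr ↦ ?_
  rw [(hasDerivAt_arcLength hα hp (interior_subset hr)).deriv]
  exact Real.exp_pos _

theorem lintegral_Ioo_exp {r s : ℝ} (hr : r ∈ openInterval a b) (hs : s ∈ openInterval a b)
    (hrs : r ≤ s) :
    ∫⁻ x in Ioo r s, ENNReal.ofReal (Real.exp (α x))
      = ENNReal.ofReal (arcLength α p s - arcLength α p r) := by
  have h1 := intervalIntegrable_exp hα hp hr
  have h2 := intervalIntegrable_exp hα hp hs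
  have h3 := intervalIntegrable_exp hα hr hs
  rw [arcLength, arcLength, intervalIntegral.integral_interval_sub_left h2 h1,
    intervalIntegral.integral_of_le hrs, ofReal_integral_eq_lintegral_ofReal
      ((intervalIntegrable_iff_integrableOn_Ioc_of_le hrs).1 h3)
      (Eventually.of_forall fun x ↦ (Real.exp_pos _).le), restrict_Ioo_eq_restrict_Ioc]

theorem lintegral_left_eq_top_iff :
    ∫⁻ r in {r : ℝ | a < (r : EReal) ∧ r < p}, ENNReal.ofReal (Real.exp (α r)) = ⊤ ↔
      ∀ y : ℝ, ∃ r ∈ openInterval a b, arcLength α p r < y := by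
  constructor
  · intro h y
    by_contra! hy
    refine h.not_lt (lt_of_le_of_lt ?_ (ENNReal.ofReal_lt_top (r := -y)))
    have hset : {r : ℝ | a < (r : EReal) ∧ r < p}
        = ⋃ q : {q : ℚ // (q : ℝ) ∈ openInterval a b}, Ioo (q : ℝ) p := by
      ext r
      simp only [mem_ofPred_eq, mem_iUnion, mem_Ioo]
      constructor
      · intro hr
        obtain ⟨q, hq, hqr⟩ :=
          exists_openInterval_lt (b := b) ⟨hr.1, (EReal.coe_lt_coe_iff.2 hr.2).trans hp.2⟩
        exact ⟨⟨q, hq⟩, hqr, hr.2⟩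
      · rintro ⟨q, hq, hr⟩
        exact ⟨q.2.1.trans (EReal.coe_lt_coe_iff.2 hq), hr⟩
    rw [hset, setLIntegral_iUnion_of_directed]
    · refine iSup_le fun q ↦ ?_
      rcases le_total (q : ℝ) p with hq | hq
      · rw [lintegral_Ioo_exp hα hp q.2 hp hq, arcLength_self]
        exact ENNReal.ofReal_le_ofReal (by linarith [hy _ q.2])
      · simp [Ioo_eq_empty_of_le hq]
    · intro q q'
      rcases le_total q q' with hq | hq
      · exact ⟨q, subset_rfl, Ioo_subset_Ioo_left (Rat.cast_le.2 hq)⟩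
      · exact ⟨q', Ioo_subset_Ioo_left (Rat.cast_le.2 hq), subset_rfl⟩
  · intro h
    refine ENNReal.eq_top_of_forall_nnreal_le fun c ↦ ?_
    obtain ⟨r, hr, hrc⟩ := h (-c)
    have hrp : r < p := by
      rw [← (strictMonoOn_arcLength hα hp).lt_iff_lt hr hp, arcLength_self]
      exact hrc.trans_le (by simp)
    have hsub : Ioo r p ⊆ {r : ℝ | a < (r : EReal) ∧ r < p} :=
      fun x hx ↦ ⟨hr.1.trans (EReal.coe_lt_coe_iff.2 hx.1), hx.2⟩
    refine le_trans ?_ (lintegral_mono_set hsub)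
    rw [lintegral_Ioo_exp hα hp hr hp hrp.le, arcLength_self, ← ENNReal.ofReal_coe_nnreal]
    exact ENNReal.ofReal_le_ofReal (by linarith)

theorem lintegral_right_eq_top_iff :
    ∫⁻ r in {r : ℝ | p < r ∧ (r : EReal) < b}, ENNReal.ofReal (Real.exp (α r)) = ⊤ ↔
      ∀ y : ℝ, ∃ r ∈ openInterval a b, y < arcLength α p r := by
  constructor
  · intro h y
    by_contra! hy
    refine h.not_lt (lt_of_le_of_lt ?_ (ENNReal.ofReal_lt_top (r := y)))
    have hset : {r : ℝ | p < r ∧ (r : EReal) < b}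
        = ⋃ q : {q : ℚ // (q : ℝ) ∈ openInterval a b}, Ioo p (q : ℝ) := by
      ext r
      simp only [mem_ofPred_eq, mem_iUnion, mem_Ioo]
      constructor
      · intro hr
        obtain ⟨q, hq, hqr⟩ :=
          exists_openInterval_gt (a := a) ⟨hp.1.trans (EReal.coe_lt_coe_iff.2 hr.1), hr.2⟩
        exact ⟨⟨q, hq⟩, hr.1, hqr⟩
      · rintro ⟨q, hr, hq⟩
        exact ⟨hr, (EReal.coe_lt_coe_iff.2 hq).trans q.2.2⟩
    rw [hset, setLIntegral_iUnion_of_directed]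
    · refine iSup_le fun q ↦ ?_
      rcases le_total p (q : ℝ) with hq | hq
      · rw [lintegral_Ioo_exp hα hp hp q.2 hq, arcLength_self]
        exact ENNReal.ofReal_le_ofReal (by linarith [hy _ q.2])
      · simp [Ioo_eq_empty_of_le hq]
    · intro q q'
      rcases le_total q q' with hq | hq
      · exact ⟨q', Ioo_subset_Ioo_right (Rat.cast_le.2 hq), subset_rfl⟩
      · exact ⟨q, subset_rfl, Ioo_subset_Ioo_right (Rat.cast_le.2 hq)⟩
  · intro h
    refine ENNReal.eq_top_of_forall_nnreal_le fun c ↦ ?_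
    obtain ⟨r, hr, hrc⟩ := h c
    have hrp : p < r := by
      rw [← (strictMonoOn_arcLength hα hp).lt_iff_lt hp hr, arcLength_self]
      exact lt_of_le_of_lt (by simp) hrc
    have hsub : Ioo p r ⊆ {r : ℝ | p < r ∧ (r : EReal) < b} :=
      fun x hx ↦ ⟨hx.1, (EReal.coe_lt_coe_iff.2 hx.2).trans hr.2⟩
    refine le_trans ?_ (lintegral_mono_set hsub)
    rw [lintegral_Ioo_exp hα hp hp hr hrp.le, arcLength_self, ← ENNReal.ofReal_coe_nnreal]
    exact ENNReal.ofReal_le_ofReal (by linarith)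

theorem arcLength_image_eq_univ_iff :
    arcLength α p '' openInterval a b = univ ↔
      (∫⁻ r in {r : ℝ | a < (r : EReal) ∧ r < p}, ENNReal.ofReal (Real.exp (α r)) = ⊤) ∧
      (∫⁻ r in {r : ℝ | p < r ∧ (r : EReal) < b}, ENNReal.ofReal (Real.exp (α r)) = ⊤) := by
  rw [lintegral_left_eq_top_iff hα hp, lintegral_right_eq_top_iff hα hp]
  constructor
  · intro h
    refine ⟨fun y ↦ ?_, fun y ↦ ?_⟩
    · obtain ⟨r, hr, hry⟩ := h.symm ▸ mem_univ (y - 1)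
      exact ⟨r, hr, by linarith⟩
    · obtain ⟨r, hr, hry⟩ := h.symm ▸ mem_univ (y + 1)
      exact ⟨r, hr, by linarith⟩
  · rintro ⟨h₁, h₂⟩
    refine eq_univ_of_forall fun y ↦ ?_
    obtain ⟨r, hr, hry⟩ := h₁ y
    obtain ⟨s, hs, hys⟩ := h₂ y
    exact (ordConnected_openInterval a b).isPreconnected.intermediate_value hr hs
      (continuousOn_arcLength hα hp) ⟨hry.le, hys.le⟩

theorem isOpen_arcLength_image : IsOpen (arcLength α p '' openInterval a b) := by
  refine isOpen_iff_mem_nhds.2 ?_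
  rintro _ ⟨r, hr, rfl⟩
  obtain ⟨s, hs, hsr⟩ := exists_openInterval_lt hr
  obtain ⟨t, ht, hrt⟩ := exists_openInterval_gt hr
  refine mem_of_superset (Icc_mem_nhds (strictMonoOn_arcLength hα hp hs hr hsr)
    (strictMonoOn_arcLength hα hp hr ht hrt)) ?_
  exact (ordConnected_openInterval a b).isPreconnected.intermediate_value hs ht
      (continuousOn_arcLength hα hp)

end ArcLength

theorem exists_contMDiffOn_section_val (a b : EReal) (r₀ : openInterval a b) :
    ∃ σ : ℝ → openInterval a b, ContMDiffOn 𝓘(ℝ, ℝ) 𝓘(ℝ, ℝ) 1 σ (openInterval a b) ∧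
      ∀ r ∈ openInterval a b, (σ r : ℝ) = r := by
  have hs : ∀ x : openInterval a b, x ∈ (chartAt ℝ r₀).source := fun x ↦ by
    simp [TopologicalSpace.Opens.chartAt_eq, chartAt_self_eq]
  refine ⟨(chartAt ℝ r₀).symm, ?_, fun x hx ↦ ?_⟩
  · exact (contMDiffOn_chart_symm (I := 𝓘(ℝ, ℝ)) (x := r₀)).mono
      fun x hx ↦ (chartAt ℝ r₀).map_source (hs ⟨x, hx⟩)
  · exact congrArg Subtype.val ((chartAt ℝ r₀).left_inv (hs ⟨x, hx⟩))

section Warped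
variable {E : Type*} [NormedAddCommGroup E] [NormedSpace ℝ E] [FiniteDimensional ℝ E]
  {H : Type*} [TopologicalSpace H] {I : ModelWithCorners ℝ E H}
  {K : Type*} [TopologicalSpace K] [ChartedSpace H K] [IsManifold I ∞ K]
  {a b : EReal} {α β : ℝ → ℝ} (hα : ContDiffOn ℝ ∞ α (openInterval a b))
  (hβ : ContDiffOn ℝ ∞ β (openInterval a b)) (g : SmoothMetric I K)
  {p : ℝ} (hp : p ∈ openInterval a b)

theorem warpedMetric_inner_apply (q : openInterval a b × K) (v w : ℝ × E) :
    (warpedMetric a b α β hα hβ g).inner q v w = Real.exp (2 * α q.1) * (v.1 * w.1)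
      + Real.exp (2 * β q.1) * g.inner q.2 v.2 w.2 :=
  warpedForm_apply a b α β g q v w

omit [FiniteDimensional ℝ E] [IsManifold I ∞ K] in
theorem mfderiv_radial (q : openInterval a b × K) :
    mfderiv (𝓘(ℝ, ℝ).prod I) 𝓘(ℝ, ℝ) (fun q : openInterval a b × K ↦ (q.1 : ℝ)) q
      = ContinuousLinearMap.fst ℝ ℝ E :=
  ((hasMFDerivAt_val a b q.1).comp q (hasMFDerivAt_fst q)).mfderiv

include hp in
/-- The radial arc length is distance non-increasing. -/
theorem edist_arcLength_le (x y : openInterval a b × K) :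
    edist (arcLength α p x.1) (arcLength α p y.1) ≤ riemDist (warpedMetric a b α β hα hβ g) x y := by
  refine edist_le_riemDist _ (f := fun q : openInterval a b × K ↦ arcLength α p q.1) ?_ ?_ x y
  · exact (contDiffOn_arcLength hα.continuousOn hp).contMDiffOn.comp_contMDiff
      (contMDiff_subtype_val.comp contMDiff_fst) fun q ↦ q.1.2
  · intro q (v : ℝ × E) c hc
    have h1 := ((hasDerivAt_arcLength hα.continuousOn hp
      q.1.2).hasFDerivAt.hasMFDerivAt.comp q ((hasMFDerivAt_val a b q.1).comp q
        (hasMFDerivAt_fst (I := 𝓘(ℝ, ℝ)) (I' := I) q))).mfderiv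
    have h2 : c = v.1 * Real.exp (α q.1) := hc.trans (congrArg (fun L : ℝ × E →L[ℝ] ℝ ↦ L v) h1)
    have h3 := g.inner_self_nonneg q.2 v.2
    have h4 : Real.exp (2 * α q.1) = Real.exp (α q.1) ^ 2 := by
      rw [← Real.exp_nat_mul]; norm_num
    have h5 := Real.exp_pos (2 * β q.1)
    rw [h2]
    refine le_of_le_of_eq ?_ (warpedMetric_inner_apply hα hβ g q v v).symm
    rw [h4, mul_pow]
    nlinarith [mul_nonneg h5.le h3]

include hp in
/-- Radial segments have length at most the difference of the arc lengths. -/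
theorem riemDist_radial_le (r s : openInterval a b) (k : K) :
    riemDist (warpedMetric a b α β hα hβ g) (r, k) (s, k)
      ≤ edist (arcLength α p r) (arcLength α p s) := by
  wlog hrs : (r : ℝ) ≤ s generalizing r s
  · rw [riemDist_comm, edist_comm]
    exact this s r (le_of_not_ge hrs)
  obtain ⟨σ, hσ, hσv⟩ := exists_contMDiffOn_section_val a b r
  have hsub : Icc (r : ℝ) s ⊆ openInterval a b := (ordConnected_openInterval a b).out r.2 s.2
  have hγ : ContMDiffOn 𝓘(ℝ, ℝ) (𝓘(ℝ, ℝ).prod I) 1 (fun t ↦ (σ t, k)) (openInterval a b) :=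
    hσ.prodMk contMDiffOn_const
  have h := riemDist_le_curveLength (warpedMetric a b α β hα hβ g) (hγ.mono hsub) hrs
  have hr : σ r = r := Subtype.ext (hσv r r.2)
  have hs : σ s = s := Subtype.ext (hσv s s.2)
  simp only [hr, hs] at h
  refine h.trans ?_
  rw [edist_comm, edist_dist, Real.dist_eq, abs_of_nonneg (sub_nonneg.2
    ((strictMonoOn_arcLength hα.continuousOn hp).monotoneOn r.2 s.2 hrs)),
    ← lintegral_Ioo_exp hα.continuousOn hp r.2 s.2 hrs, curveLength,
    ← restrict_Ioo_eq_restrict_Icc]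
  refine setLIntegral_mono' measurableSet_Ioo fun u hu ↦ ENNReal.ofReal_le_ofReal ?_
  have hu' : u ∈ openInterval a b := hsub ⟨hu.1.le, hu.2.le⟩
  have hnhds := (openInterval a b).isOpen.mem_nhds hu'
  have hd : MDifferentiableAt 𝓘(ℝ, ℝ) (𝓘(ℝ, ℝ).prod I) (fun t ↦ (σ t, k)) u :=
    (hγ.contMDiffAt hnhds).mdifferentiableAt one_ne_zero
  set w : ℝ × E := velocity (𝓘(ℝ, ℝ).prod I) (fun t ↦ (σ t, k)) u with hw
  have hw1 : w.1 = 1 := by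
    have h1 := velocity_comp (I := 𝓘(ℝ, ℝ).prod I) (I' := 𝓘(ℝ, ℝ))
      (f := fun q : openInterval a b × K ↦ (q.1 : ℝ)) (γ := fun t ↦ (σ t, k))
      ((hasMFDerivAt_val a b _).comp (σ u, k) (hasMFDerivAt_fst _)).mdifferentiableAt hd
    have h2 : velocity 𝓘(ℝ, ℝ) ((fun q : openInterval a b × K ↦ (q.1 : ℝ)) ∘ fun t ↦ (σ t, k)) u
        = w.1 := h1.trans (congrArg (fun L : ℝ × E →L[ℝ] ℝ ↦ L w) (mfderiv_radial (σ u, k)))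
    rw [← h2]
    have h3 : ((fun q : openInterval a b × K ↦ (q.1 : ℝ)) ∘ fun t ↦ (σ t, k)) =ᶠ[𝓝 u] id :=
      mem_of_superset hnhds fun t ht ↦ hσv t ht
    exact congrArg (fun L : ℝ →L[ℝ] ℝ ↦ L 1) (h3.mfderiv_eq.trans mfderiv_id)
  have hw2 : w.2 = 0 := by
    have h1 := velocity_comp (I := 𝓘(ℝ, ℝ).prod I) (I' := I)
      (f := fun q : openInterval a b × K ↦ q.2) (γ := fun t ↦ (σ t, k))
      mdifferentiableAt_snd hd
    have h2 : velocity I ((fun q : openInterval a b × K ↦ q.2) ∘ fun t ↦ (σ t, k)) u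
        = w.2 := h1.trans (congrArg (fun L : ℝ × E →L[ℝ] E ↦ L w) mfderiv_snd)
    rw [← h2]
    exact congrArg (fun L : ℝ →L[ℝ] E ↦ L 1)
      (mfderiv_const (I := 𝓘(ℝ, ℝ)) (I' := I) (c := k) (x := u))
  refine le_of_eq ?_
  rw [← Real.sqrt_sq (Real.exp_pos (α u)).le]
  refine congrArg Real.sqrt ((warpedMetric_inner_apply hα hβ g (σ u, k) w w).trans ?_)
  have h0 : g.inner k w.2 w.2 = 0 := by rw [hw2]; exact map_zero _
  dsimp only
  rw [h0, hw1, hσv u hu', ← Real.exp_nat_mul]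
  simp

theorem riemDist_fibre_le (r : openInterval a b) (k l : K) :
    riemDist (warpedMetric a b α β hα hβ g) (r, k) (r, l)
      ≤ ENNReal.ofReal (Real.exp (β r)) * riemDist g k l := by
  refine riemDist_map_le g (warpedMetric a b α β hα hβ g) (f := fun k ↦ (r, k))
    (contMDiff_const.prodMk contMDiff_id) (Real.exp_pos _) (fun x v ↦ ?_) k l
  have h1 : mfderiv I (𝓘(ℝ, ℝ).prod I) (fun k : K ↦ (r, k)) x
      = ContinuousLinearMap.inr ℝ ℝ E := mfderiv_prod_right
  have h2 : (mfderiv I (𝓘(ℝ, ℝ).prod I) (fun k : K ↦ (r, k)) x v : ℝ × E) = ((0, v) : ℝ × E) :=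
    congrArg (fun L : E →L[ℝ] ℝ × E ↦ L v) h1
  rw [h2]
  refine le_of_eq ((warpedMetric_inner_apply hα hβ g (r, x) _ _).trans ?_)
  rw [← Real.exp_nat_mul]
  simp

include hp in
/-- Over a part of the interval on which `β` is bounded below, the projection to the fibre is
Lipschitz at small scales. -/
theorem riemDist_snd_lt {y c : ℝ}
    (hc : ∀ r ∈ openInterval a b, dist (arcLength α p r) y ≤ 2 → c ≤ β r)
    {x z : openInterval a b × K} (hx : dist (arcLength α p x.1) y ≤ 1) {ε : ℝ≥0∞} (hε : ε ≤ 1)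
    (h : riemDist (warpedMetric a b α β hα hβ g) x z < ε) :
    riemDist g x.2 z.2 < ENNReal.ofReal (Real.exp (-c)) * ε := by
  obtain ⟨γ, rfl, rfl, hγ, hl⟩ := exists_curveLength_lt _ h
  have hstay : ∀ u ∈ Icc (0 : ℝ) 1, c ≤ β (γ u).1 := by
    intro u hu
    refine hc _ (γ u).1.2 ?_
    have h1 : edist (arcLength α p (γ 0).1) (arcLength α p (γ u).1) ≤ 1 :=
      (edist_arcLength_le hα hβ g hp _ _).trans
        ((riemDist_le_curveLength _ hγ.contMDiffOn hu.1).trans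
          ((curveLength_mono _ _ le_rfl hu.2).trans (hl.le.trans hε)))
    have h2 : dist (arcLength α p (γ 0).1) (arcLength α p (γ u).1) ≤ 1 := by
      rw [edist_dist] at h1
      exact ENNReal.ofReal_le_one.1 h1
    have := dist_triangle_left (arcLength α p (γ u).1) y (arcLength α p (γ 0).1)
    linarith
  refine (riemDist_le_curveLength g (γ := fun u ↦ (γ u).2)
    (contMDiff_snd.comp hγ).contMDiffOn zero_le_one).trans_lt ?_
  refine (curveLength_comp_le (warpedMetric a b α β hα hβ g) g (f := Prod.snd) contMDiff_snd hγ
    (Real.exp_pos (-c)).le fun u hu (v : ℝ × E) ↦ ?_).trans_lt ?_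
  · have h1 : (mfderiv (𝓘(ℝ, ℝ).prod I) I (Prod.snd : openInterval a b × K → K) (γ u) v : E)
        = v.2 := congrArg (fun L : ℝ × E →L[ℝ] E ↦ L v) mfderiv_snd
    rw [h1]
    refine le_of_le_of_eq ?_
      (congrArg (Real.exp (-c) ^ 2 * ·) (warpedMetric_inner_apply hα hβ g (γ u) v v)).symm
    have h3 : 0 ≤ g.inner (γ u).2 v.2 v.2 := g.inner_self_nonneg _ _
    have h4 : 1 ≤ Real.exp (-c) ^ 2 * Real.exp (2 * β (γ u).1) := by
      rw [← Real.exp_nat_mul, ← Real.exp_add]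
      refine Real.one_le_exp ?_
      have := hstay u hu
      push_cast
      linarith
    have h5 := Real.exp_pos (2 * α (γ u).1)
    calc _ ≤ Real.exp (-c) ^ 2 * Real.exp (2 * β (γ u).1) * g.inner (γ u).2 v.2 v.2 :=
          le_mul_of_one_le_left h3 h4
      _ ≤ _ := by
        rw [mul_add, mul_assoc]
        exact le_add_of_nonneg_left (by have := mul_self_nonneg v.1; positivity)
  · exact (ENNReal.mul_lt_mul_iff_right (by simpa using Real.exp_pos _) ENNReal.ofReal_ne_top).2 hl

include hp in
theorem arcLength_image_eq_univ_of_isComplete [Nonempty K]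
    (h : IsCompleteRiemannian (warpedMetric a b α β hα hβ g)) :
    arcLength α p '' openInterval a b = univ := by
  obtain ⟨k⟩ := ‹Nonempty K›
  refine IsClopen.eq_univ ⟨isClosed_of_closure_subset fun y hy ↦ ?_,
    isOpen_arcLength_image hα.continuousOn hp⟩ ⟨_, p, hp, rfl⟩
  obtain ⟨v, hv, hvy⟩ := mem_closure_iff_seq_limit.1 hy
  choose r hr hrv using hv
  obtain ⟨x, hx⟩ := h (fun n ↦ (⟨r n, hr n⟩, k)) fun ε hε ↦ by
    obtain ⟨n₀, hn₀⟩ := EMetric.cauchySeq_iff.1 hvy.cauchySeq ε hε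
    refine ⟨n₀, fun m hm n hn ↦ (riemDist_radial_le hα hβ g hp _ _ k).trans_lt ?_⟩
    simpa only [hrv] using hn₀ m hm n hn
  refine ⟨x.1, x.1.2, tendsto_nhds_unique (tendsto_iff_edist_tendsto_0.2 ?_) hvy⟩
  refine tendsto_of_tendsto_of_tendsto_of_le_of_le tendsto_const_nhds hx (fun _ ↦ zero_le)
    fun n ↦ ?_
  have := edist_arcLength_le hα hβ g hp (⟨r n, hr n⟩, k) x
  simpa only [hrv] using this

include hp in
theorem isComplete_of_arcLength_image_eq_univ (hK : IsCompleteRiemannian g)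
    (h : arcLength α p '' openInterval a b = univ) :
    IsCompleteRiemannian (warpedMetric a b α β hα hβ g) := by
  intro u hu
  have hF : CauchySeq fun n ↦ arcLength α p (u n).1 := by
    refine EMetric.cauchySeq_iff.2 fun ε hε ↦ ?_
    obtain ⟨n₀, hn₀⟩ := hu ε hε
    exact ⟨n₀, fun m hm n hn ↦ (edist_arcLength_le hα hβ g hp _ _).trans_lt (hn₀ m hm n hn)⟩
  obtain ⟨y, hy⟩ := cauchySeq_tendsto_of_complete hF
  obtain ⟨r, hr, rfl⟩ := h.symm ▸ mem_univ y
  set y := arcLength α p r with hy_def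
  obtain ⟨s, hs, hsy⟩ := h.symm ▸ mem_univ (y - 2)
  obtain ⟨t, ht, hty⟩ := h.symm ▸ mem_univ (y + 2)
  have hmono := strictMonoOn_arcLength hα.continuousOn hp
  obtain ⟨c, hc⟩ := ((isCompact_Icc (a := s) (b := t)).image_of_continuousOn
    (hβ.continuousOn.mono ((ordConnected_openInterval a b).out hs ht))).bddBelow
  have hcβ : ∀ r ∈ openInterval a b, dist (arcLength α p r) y ≤ 2 → c ≤ β r := by
    intro r' hr' hd
    rw [Real.dist_eq, abs_le] at hd
    exact hc ⟨r', ⟨(hmono.le_iff_le hs hr').1 (by linarith), (hmono.le_iff_le hr' ht).1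
      (by linarith)⟩, rfl⟩
  obtain ⟨n₁, hn₁⟩ := Metric.tendsto_atTop.1 hy 1 one_pos
  obtain ⟨k, hk⟩ := hK (fun n ↦ (u n).2) fun ε hε ↦ by
    set C := ENNReal.ofReal (Real.exp (-c))
    have hC : C ≠ 0 := by simpa [C] using Real.exp_pos _
    obtain ⟨n₀, hn₀⟩ := hu (min 1 (ε / C))
      (lt_min one_pos (ENNReal.div_pos hε.ne' ENNReal.ofReal_ne_top))
    refine ⟨max n₀ n₁, fun m hm n hn ↦ ?_⟩
    refine (riemDist_snd_lt hα hβ g hp hcβ (hn₁ m (le_of_max_le_right hm)).le (min_le_left _ _)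
      (hn₀ m (le_of_max_le_left hm) n (le_of_max_le_left hn))).trans_le ?_
    calc C * min 1 (ε / C) ≤ C * (ε / C) := by gcongr; exact min_le_right _ _
      _ ≤ ε := ENNReal.mul_div_le
  refine ⟨(⟨r, hr⟩, k), ?_⟩
  have hlim : Tendsto (fun n ↦ edist (arcLength α p (u n).1) y
      + ENNReal.ofReal (Real.exp (β r)) * riemDist g (u n).2 k) atTop (𝓝 0) := by
    have h2 := ENNReal.Tendsto.const_mul (a := ENNReal.ofReal (Real.exp (β r))) hk
      (Or.inr ENNReal.ofReal_ne_top)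
    simpa using (tendsto_iff_edist_tendsto_0.1 hy).add h2
  refine tendsto_of_tendsto_of_tendsto_of_le_of_le tendsto_const_nhds hlim (fun _ ↦ zero_le)
    fun n ↦ ?_
  exact (riemDist_triangle _ _ (⟨r, hr⟩, (u n).2) _).trans
    (add_le_add (riemDist_radial_le hα hβ g hp (u n).1 ⟨r, hr⟩ (u n).2)
      (riemDist_fibre_le hα hβ g ⟨r, hr⟩ (u n).2 k))

include hp in
/-- A warped product over an interval with complete fibre is complete if and only if both ends of
the interval are at infinite distance. -/
theorem isCompleteRiemannian_warpedMetric_iff [Nonempty K] (hK : IsCompleteRiemannian g) :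
    IsCompleteRiemannian (warpedMetric a b α β hα hβ g) ↔
      (∫⁻ r in {r : ℝ | a < (r : EReal) ∧ r < p}, ENNReal.ofReal (Real.exp (α r)) = ⊤) ∧
      (∫⁻ r in {r : ℝ | p < r ∧ (r : EReal) < b}, ENNReal.ofReal (Real.exp (α r)) = ⊤) := by
  rw [← arcLength_image_eq_univ_iff hα.continuousOn hp]
  exact ⟨arcLength_image_eq_univ_of_isComplete hα hβ g hp,
    isComplete_of_arcLength_image_eq_univ hα hβ g hp hK⟩

end Warped
end WarpedHom

theorem mainTheorem7 (a b : EReal) (α β : ℝ → ℝ)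
    (hα : ContDiffOn ℝ ∞ α (WarpedHom.openInterval a b))
    (hβ : ContDiffOn ℝ ∞ β (WarpedHom.openInterval a b))
    (p : ℝ) (hap : a < (p : EReal)) (hpb : (p : EReal) < b) :
    (∀ (E : Type*) [NormedAddCommGroup E] [NormedSpace ℝ E] [FiniteDimensional ℝ E]
      (H : Type*) [TopologicalSpace H] (I : ModelWithCorners ℝ E H) [I.Boundaryless]
      (K : Type*) [TopologicalSpace K] [T2Space K] [Nonempty K] [ChartedSpace H K]
      [IsManifold I ∞ K] (g : WarpedHom.SmoothMetric I K),
      WarpedHom.IsHomogeneous g →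
        (WarpedHom.IsCompleteRiemannian (WarpedHom.warpedMetric a b α β hα hβ g) ↔
          ((∫⁻ r in {r : ℝ | a < (r : EReal) ∧ r < p}, ENNReal.ofReal (Real.exp (α r))) = ⊤) ∧
          ((∫⁻ r in {r : ℝ | p < r ∧ (r : EReal) < b}, ENNReal.ofReal (Real.exp (α r))) = ⊤))) ∧
    (WarpedHom.IsCompleteRiemannian
        (WarpedHom.warpedMetric a b α β hα hβ WarpedHom.sphereMetric) ↔
      ((∫⁻ r in {r : ℝ | a < (r : EReal) ∧ r < p}, ENNReal.ofReal (Real.exp (α r))) = ⊤) ∧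
      ((∫⁻ r in {r : ℝ | p < r ∧ (r : EReal) < b}, ENNReal.ofReal (Real.exp (α r))) = ⊤)) := by
  refine ⟨?_, ?_⟩
  · intro E _ _ _ H _ I _ K _ _ _ _ _ g hg
    exact WarpedHom.isCompleteRiemannian_warpedMetric_iff hα hβ g ⟨hap, hpb⟩
      hg.isCompleteRiemannian
  · have : Nonempty (Metric.sphere (0 : EuclideanSpace ℝ (Fin 3)) 1) :=
      (NormedSpace.sphere_nonempty.2 zero_le_one).to_subtype
    exact WarpedHom.isCompleteRiemannian_warpedMetric_iff hα hβ _ ⟨hap, hpb⟩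
      (WarpedHom.isCompleteRiemannian_of_compactSpace _)
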